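/- Let $\Omega$ be a ground set, $k\ge 1$, and let $f$ be a non-negative submodular, not necessarily monotone, function on the finite subsets of $\Omega$. Distinct elements of $\Omega$ arrive one by one in a finite sequence that is fixed in advance but unknown to the algorithm. An online algorithm with free disposal under the $k$-uniform matroid constraint starts with the empty set; in each round it may discard elements and may add the arriving element, always holding at most $k$ elements, and it may query $f$ on sets of elements that have arrived. A (randomized) algorithm has competitive ratio $r$ if for all such $f$ and all sequences, the set $\widehat S$ held at the end satisfies $\mathbb E[f(\widehat S)]\ge r\cdot f(\mathrm{OPT})$, where $\mathrm{OPT}$ maximizes $f$ over the sets of at most $k$ elements of the sequence. Put $\rho=3$. For $k\ge1$ let $\alpha_k$ be the root $a\ge\rho+1$ of $\left(1+\frac{a-\rho-1}{\rho k+1}\right)^{\rho k+1}=a$. Let $g(S)=\mathbb E[f(R)]$, where $R$ contains each element of $S$ independently with probability $1/\rho$. The modified algorithm has $\rho k$ slots, partitioned into $k$ blocks of $\rho$ slots. Let $S$ be the set of the elements currently in the slots, and $A$ the set of all elements that have been accepted so far; both are initially empty. When $u$ arrives, let $w(u)=g(A\cup\{u\})-g(A)$, with the current $A$. For a set $T$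 of accepted elements, let $w(T)=\sum_{v\in T}w(v)$. The element $u$ is accepted if and only if $$w(u)>\frac1{\rho k}\bigl(\alpha_k\, w(S)-\rho\, w(A)\bigr).$$ If it is accepted, it is added to $A$ and put into an empty slot if there is one; otherwise it replaces an element $v\in S$ of minimum $w(v)$ in the slot of $v$ (the choice of the empty slot and of the minimizer is an arbitrary deterministic rule depending on the current state). At the beginning, one slot is selected in each block, uniformly and independently, and at every time the set $\widehat S$ held by the algorithm consists of the elements of $S$ in the selected slots. The best-singleton algorithm starts with the empty set and replaces its current set by $\{u\}$ whenever this strictly increases $f$. Theorem. The number $\alpha_k$ exists and is unique for each $k\ge 1$. The modified algorithm is an online algorithm under the $k$-uniform matroid constraint with competitive ratio $\frac1{\alpha_k}\left(1-\frac1\rho\right)$. Corollary. The best-singleton algorithm has competitive ratio $\frac1k$. Hence the randomized algorithm that, for given $k$, runs the one of the two algorithms with the larger guaranteed ratio has competitive ratio $\max\left\{\frac1k,\frac1{\alpha_k}\left(1-\frac1\rho\right)\right\}$, which for all $k\ge 1$ is at least $$\min_{k\ge1}\max\left\{\frac1k,\frac1{\alpha_k}\left(1-\frac1\rho\right)\right\}=\max\left\{\frac19,\frac1{\alpha_9}\left(1-\frac1\rho\right)\right\}>0.1145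 .$$ -/

import Mathlib

open Finset

namespace OnlineSubmodular

variable {Ω : Type*} [DecidableEq Ω]

/-- Submodularity of a set function (no monotonicity is required). -/
def IsSubmodular (f : Finset Ω → ℝ) : Prop :=
  ∀ S T : Finset Ω, f (S ∪ T) + f (S ∩ T) ≤ f S + f T

/-- The optimal value for the `k`-uniform matroid: the maximum of `f` over all sets of at most `k`
elements of the sequence `l`. -/
noncomputable def optValue (k : ℕ) (f : Finset Ω → ℝ) (l : List Ω) : ℝ :=
  (l.toFinset.powerset.filter fun S => S.card ≤ k).sup' ⟨∅, by simp⟩ f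

/-- A randomized procedure (with finitely many random seeds, drawn once at the beginning) which
reads an input sequence: `out r f l` is the set held with seed `r` and objective `f`
after the elements of the list `l` have arrived, in this order. -/
structure RandAlg (Ω : Type*) where
  Seed : Type
  [seedFintype : Fintype Seed]
  law : PMF Seed
  out : Seed → (Finset Ω → ℝ) → List Ω → Finset Ω

attribute [instance] RandAlg.seedFintype

namespace RandAlg

/-- `alg` is an online algorithm with free disposal under the `k`-uniform matroid constraint and
with value-oracle access to the objective: it starts with the empty set; in each round it may
discard elements and may add only the arriving element; it always holds at most `k` elements;
and what it holds depends only on the seed, on the sequence seen so far, and on the values of the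
objective on sets of elements seen so far. -/
structure IsOnline (k : ℕ) (alg : RandAlg Ω) : Prop where
  start : ∀ r f, alg.out r f [] = ∅
  round : ∀ r f l u, alg.out r f (l ++ [u]) ⊆ insert u (alg.out r f l)
  feasible : ∀ r f l, (alg.out r f l).card ≤ k
  oracle : ∀ r f f' l, (∀ T, T ⊆ l.toFinset → f T = f' T) → alg.out r f l = alg.out r f' l

/-- The expected objective value at the end of the sequence `l`. -/
noncomputable def expValue (alg : RandAlg Ω) (f : Finset Ω → ℝ) (l : List Ω) : ℝ :=
  ∑ r : alg.Seed, (alg.law r).toReal * f (alg.out r f l)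

/-- Competitive ratio `ρ` for non-negative, not necessarily monotone, submodular objectives under
the `k`-uniform matroid, on all finite sequences of distinct elements. -/
def HasCompetitiveRatio (k : ℕ) (alg : RandAlg Ω) (ρ : ℝ) : Prop :=
  ∀ f : Finset Ω → ℝ, (∀ S, 0 ≤ f S) → IsSubmodular f →
    ∀ l : List Ω, l.Nodup → ρ * optValue k f l ≤ alg.expValue f l

end RandAlg

/-- The function `f̂_p`: the expectation of `f` at the random subset of `S` that contains each
element of `S` independently with probability `p`. -/
noncomputable def sampled (p : ℝ) (f : Finset Ω → ℝ) (S : Finset Ω) : ℝ :=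
  ∑ T ∈ S.powerset, p ^ T.card * (1 - p) ^ (S \ T).card * f T

/-- `a` is a root of `(1 + (a - ρ - 1) / (ρ k + 1)) ^ (ρ k + 1) = a` with `a ≥ ρ + 1`,
where `ρ = 3`. -/
def IsAlpha (k : ℕ) (a : ℝ) : Prop :=
  3 + 1 ≤ a ∧ (1 + (a - 3 - 1) / (3 * (k : ℝ) + 1)) ^ (3 * k + 1) = a

/-- The constant `α_k`. -/
noncomputable def alpha (k : ℕ) : ℝ := sInf {a : ℝ | IsAlpha k a}

/-- The state of the modified algorithm: the content of the `3 k` slots, where `(i, c)` is the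
`c`-th slot of the `i`-th block of three; the set `A` of all elements accepted so far; and the
weights `w` that were recorded for these elements when they arrived. -/
structure State (Ω : Type*) (k : ℕ) where
  slots : Fin k × Fin 3 → Option Ω
  A : Finset Ω
  w : Ω → ℝ

/-- The set `S` of elements that occupy some slot. -/
def State.S {k : ℕ} (s : State Ω k) : Finset Ω :=
  univ.biUnion fun j => (s.slots j).toFinset

/-- How the algorithm chooses the slot for an accepted element: as long as there is an empty slot,
an empty slot; otherwise, the slot of an element of minimum weight. Ties are broken arbitrarily. -/
structure SlotRule (Ω : Type*) (k : ℕ) where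
  slot : State Ω k → Fin k × Fin 3
  slot_empty : ∀ s : State Ω k, (∃ j, s.slots j = none) → s.slots (slot s) = none
  slot_argmin : ∀ s : State Ω k, (∀ j, s.slots j ≠ none) →
    ∀ v, s.slots (slot s) = some v → ∀ j v', s.slots j = some v' → s.w v ≤ s.w v'

/-- One round of the modified algorithm, in which `u` arrives: with `g = f̂_{1/3}` and
`w(u) = g(A + u) - g(A)`, the element `u` is accepted if and only if
`w(u) > (α_k w(S) - 3 w(A)) / (3 k)`. -/
noncomputable def step {k : ℕ} (rule : SlotRule Ω k) (f : Finset Ω → ℝ)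
    (s : State Ω k) (u : Ω) : State Ω k :=
  let wu : ℝ := sampled (1 / 3) f (insert u s.A) - sampled (1 / 3) f s.A
  if 1 / (3 * (k : ℝ)) * (alpha k * ∑ v ∈ s.S, s.w v - 3 * ∑ v ∈ s.A, s.w v) < wu then
    { slots := Function.update s.slots (rule.slot s) (some u)
      A := insert u s.A
      w := Function.update s.w u wu }
  else s

/-- The state after the sequence `l`, starting with empty slots and `A = ∅`. -/
noncomputable def run {k : ℕ} (rule : SlotRule Ω k) (f : Finset Ω → ℝ) (l : List Ω) : State Ω k :=
  l.foldl (step rule f) { slots := fun _ => none, A := ∅, w := fun _ => 0 }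

/-- The modified algorithm: one slot `c i` is selected in each block `i`, independently
and uniformly at random, and the algorithm holds the elements of `S` in the selected slots. -/
noncomputable def modifiedAlg {k : ℕ} (rule : SlotRule Ω k) : RandAlg Ω where
  Seed := Fin k → Fin 3
  law := PMF.uniformOfFintype (Fin k → Fin 3)
  out := fun c f l => univ.biUnion fun i => ((run rule f l).slots (i, c i)).toFinset

/-- The deterministic algorithm that keeps the best singleton: starting with the empty set, it
replaces the current set by `{u}` if this increases the objective. -/
noncomputable def singletonAlg (Ω : Type*) : RandAlg Ω where
  Seed := Unit
  law := PMF.pure ()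
  out := fun _ f l => l.foldl (fun S u => if f S < f {u} then {u} else S) ∅

/-- The ratio guaranteed by the modified algorithm, `(1 / α_k) (1 - 1 / ρ)` with `ρ = 3`. -/
noncomputable def modifiedRatio (k : ℕ) : ℝ := 1 / alpha k * (1 - 1 / 3)

/-- The combination of the two algorithms: for given `k`, the best-singleton algorithm if its
ratio `1 / k` is at least that of the modified algorithm, and the modified algorithm otherwise. -/
noncomputable def combinedAlg {k : ℕ} (rule : SlotRule Ω k) : RandAlg Ω :=
  if modifiedRatio k ≤ 1 / (k : ℝ) then singletonAlg Ω else modifiedAlg rule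

end OnlineSubmodular

namespace OnlineSubmodular

/-! ### The constant `α_k` -/

/-! Write g for `sampled (1 / 3) f`, n = 3k, α for `alpha k` and Φ = α w(S) - 3 w(A). Recorded
weights telescope to w(A) = g(A) - f(∅), and since marginals of g decrease, f(∅) + w(S) ≤ g(S).

The online part is a potential argument. Put q = 1 + (α - 4)/(n + 1), so that α = q^(n+1) and α - 3
= n(q - 1) + q. In a suitable order the slot weights x_0, …, x_{n-1} satisfy ∑ q^(n-i) x_i ≤ Φ.
Replacing the minimum m by an accepted weight x changes Φ to Φ + (α - 3)x - αm; `potential_replace`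
shows that the inequality survives and that Φ never decreases. Hence an element once rejected stays
below the threshold.

At the end, with R the random subset of A, nonnegativity gives (2/3) f(O) ≤ E f(O ∪ R). Expanding
into marginals bounds this by g(A) + 2 w(A) + Φ = f(∅) + α w(S) ≤ α g(S)
(`State.Invariant.le_alpha_mul`). Choosing one slot per block is no worse than independent sampling
(`IsSubmodular.sampled_le_average`), which turns g(S) into the algorithm's expected value.

For the combined ratio, α_k is antitone in k, so bounds on α_9 settle the minimum over k. -/

/-- The left-hand side of the equation that defines `α_k`. -/
noncomputable def growth (k : ℕ) (a : ℝ) : ℝ :=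
  (1 + (a - 3 - 1) / (3 * (k : ℝ) + 1)) ^ (3 * k + 1)

/-- `growth` is convex with value 1 < 4 at 4. The chord from (4, 1) to (b, growth b) therefore lies
strictly below the diagonal before b. Uniqueness of the root and all comparisons with it follow. -/
lemma growth_lt_of_lt {k : ℕ} {a b : ℝ} (ha : 4 ≤ a) (hab : a < b) (hb : growth k b ≤ b) :
    growth k a < a := by
  unfold growth at *
  have hn : (0 : ℝ) < 3 * (k : ℝ) + 1 := by positivity
  have hb4 : 0 < b - 4 := by linarith
  set t : ℝ := (a - 4) / (b - 4) with ht
  have ht0 : 0 ≤ t := div_nonneg (by linarith) hb4.le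
  have ht1 : t < 1 := (div_lt_one hb4).2 (by linarith)
  have hta : t * (b - 4) = a - 4 := div_mul_cancel₀ _ hb4.ne'
  have hy : 0 ≤ 1 + (b - 3 - 1) / (3 * (k : ℝ) + 1) :=
    add_nonneg zero_le_one (div_nonneg (by linarith) hn.le)
  have h := (convexOn_pow (𝕜 := ℝ) (3 * k + 1)).2 (Set.mem_Ici.2 zero_le_one) (Set.mem_Ici.2 hy)
    (sub_nonneg.2 ht1.le) ht0 (by ring)
  have he : (1 - t) • (1 : ℝ) + t • (1 + (b - 3 - 1) / (3 * (k : ℝ) + 1))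
      = 1 + (a - 3 - 1) / (3 * (k : ℝ) + 1) := by
    have : a - 3 - 1 = t * (b - 3 - 1) := by linarith
    rw [this]; simp only [smul_eq_mul]; ring
  rw [he] at h
  simp only [one_pow, smul_eq_mul] at h
  have h2 := mul_le_mul_of_nonneg_left hb ht0
  nlinarith

lemma exists_isAlpha {k : ℕ} (hk : 1 ≤ k) : ∃ a, IsAlpha k a := by
  have hn : (0 : ℝ) < 3 * (k : ℝ) + 1 := by positivity
  have hcont : Continuous (fun a => growth k a - a) := by
    unfold growth; fun_prop
  have h4 : growth k 4 - 4 ≤ 0 := by norm_num [growth]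
  have hbig : 0 ≤ growth k (4 + 3 * (3 * (k : ℝ) + 1)) - (4 + 3 * (3 * (k : ℝ) + 1)) := by
    -- The upper endpoint makes the base equal to 4, so it suffices that 4 + 3n ≤ 4^n for n = 3k + 1
    -- ≥ 2.
    have e : 1 + (4 + 3 * (3 * (k : ℝ) + 1) - 3 - 1) / (3 * (k : ℝ) + 1) = 4 := by
      field_simp; ring
    have : ∀ n : ℕ, 2 ≤ n → (4 : ℝ) + 3 * n ≤ 4 ^ n := by
      intro n h
      induction n, h using Nat.le_induction with
      | base => norm_num
      | succ n h ih => rw [pow_succ]; push_cast; nlinarith [(Nat.cast_nonneg n : (0 : ℝ) ≤ n)]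
    have h := this (3 * k + 1) (by omega)
    rw [growth, e]; push_cast at h; linarith
  obtain ⟨a, ha, ha0⟩ := intermediate_value_Icc (by linarith : (4 : ℝ) ≤ 4 + 3 * (3 * (k : ℝ) + 1))
    hcont.continuousOn ⟨h4, hbig⟩
  exact ⟨a, by linarith [ha.1], by have : growth k a - a = 0 := ha0
                                   unfold growth at this; linarith⟩

lemma IsAlpha.four_le {k : ℕ} {a : ℝ} (h : IsAlpha k a) : 4 ≤ a := by linarith [h.1]

lemma IsAlpha.growth_eq {k : ℕ} {a : ℝ} (h : IsAlpha k a) : growth k a = a := h.2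

lemma IsAlpha.unique {k : ℕ} {a b : ℝ} (ha : IsAlpha k a) (hb : IsAlpha k b) : a = b := by
  rcases lt_trichotomy a b with h | h | h
  · exact absurd ha.growth_eq (growth_lt_of_lt ha.four_le h hb.growth_eq.le).ne
  · exact h
  · exact absurd hb.growth_eq (growth_lt_of_lt hb.four_le h ha.growth_eq.le).ne

lemma isAlpha_alpha {k : ℕ} (hk : 1 ≤ k) : IsAlpha k (alpha k) := by
  obtain ⟨a, ha⟩ := exists_isAlpha hk
  have : {a : ℝ | IsAlpha k a} = {a} := Set.eq_singleton_iff_unique_mem.2 ⟨ha, fun b hb => hb.unique ha⟩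
  rw [alpha, this, csInf_singleton]; exact ha

/-- Together with `IsAlpha.le_of_growth_le`, this locates the root by evaluating `growth` at one
number. -/
lemma IsAlpha.lt_of_lt_growth {k : ℕ} {a b : ℝ} (ha : IsAlpha k a) (hb : 4 ≤ b)
    (h : b < growth k b) : a < b := by
  by_contra! hba
  rcases hba.eq_or_lt with rfl | hba
  · exact h.ne' ha.growth_eq
  · exact absurd (growth_lt_of_lt hb hba ha.growth_eq.le) h.le.not_gt

lemma IsAlpha.le_of_growth_le {k : ℕ} {a b : ℝ} (ha : IsAlpha k a) (h : growth k b ≤ b) :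
    b ≤ a := by
  by_contra! hab
  exact (growth_lt_of_lt ha.four_le hab h).ne ha.growth_eq

/-- Bernoulli's inequality with real exponent (3m + 1)/(3k + 1), raised to the power 3k + 1. -/
lemma growth_mono {k m : ℕ} (hkm : k ≤ m) {a : ℝ} (ha : 4 ≤ a) : growth k a ≤ growth m a := by
  have hkm' : (k : ℝ) ≤ m := Nat.cast_le.2 hkm
  have hk : (0 : ℝ) < 3 * (k : ℝ) + 1 := by positivity
  have hm : (0 : ℝ) < 3 * (m : ℝ) + 1 := by positivity
  have hx : 0 ≤ (a - 3 - 1) / (3 * (m : ℝ) + 1) := div_nonneg (by linarith) hm.le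
  have h := one_add_mul_self_le_rpow_one_add (s := (a - 3 - 1) / (3 * (m : ℝ) + 1)) (by linarith)
    (p := (3 * (m : ℝ) + 1) / (3 * (k : ℝ) + 1)) ((one_le_div hk).2 (by linarith))
  have e : (3 * (m : ℝ) + 1) / (3 * (k : ℝ) + 1) * ((a - 3 - 1) / (3 * (m : ℝ) + 1))
      = (a - 3 - 1) / (3 * (k : ℝ) + 1) := by field_simp
  rw [e] at h
  have h2 := pow_le_pow_left₀ (add_nonneg zero_le_one (div_nonneg (by linarith) hk.le)) h (3 * k + 1)
  rw [← Real.rpow_natCast (_ ^ (_ : ℝ)) (3 * k + 1), ← Real.rpow_mul (by linarith)] at h2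
  have e2 : (3 * (m : ℝ) + 1) / (3 * (k : ℝ) + 1) * ((3 * k + 1 : ℕ) : ℝ) = ((3 * m + 1 : ℕ) : ℝ) := by
    push_cast; field_simp
  rw [e2, Real.rpow_natCast] at h2
  exact h2

lemma alpha_anti {k m : ℕ} (hk : 1 ≤ k) (hkm : k ≤ m) : alpha m ≤ alpha k := by
  have ha := isAlpha_alpha (hk.trans hkm)
  refine (isAlpha_alpha hk).le_of_growth_le ?_
  exact (growth_mono hkm ha.four_le).trans ha.growth_eq.le

/-! ### Numerical bounds at k = 9 and the worst case over k. -/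

lemma alpha_nine_lt : alpha 9 < 5.8224 :=
  (isAlpha_alpha (by norm_num)).lt_of_lt_growth (by norm_num) (by norm_num [growth])

lemma le_alpha_nine : 16 / 3 ≤ alpha 9 :=
  (isAlpha_alpha (by norm_num)).le_of_growth_le (by norm_num [growth])

/-- For k ≥ 9 antitonicity of `alpha` suffices, as α_9 < 5.8224 makes the second ratio at 9 exceed
1/9. For k ≤ 8 the ratio 1/k ≥ 1/8 suffices, as 16/3 is the value of α at which (2/3)/α = 1/8. -/
lemma max_nine_le {k : ℕ} (hk : 1 ≤ k) :
    max (1 / 9 : ℝ) (1 / alpha 9 * (1 - 1 / 3)) ≤ max (1 / (k : ℝ)) (1 / alpha k * (1 - 1 / 3)) := by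
  have h9 : (0 : ℝ) < alpha 9 := by linarith [le_alpha_nine]
  have hk0 : 0 < alpha k := by linarith [(isAlpha_alpha hk).four_le]
  have hk0' : (0 : ℝ) < k := by exact_mod_cast hk
  rcases le_or_gt 9 k with h | h
  · have h1 : 1 / alpha 9 ≤ 1 / alpha k :=
      one_div_le_one_div_of_le hk0 (alpha_anti (by norm_num) h)
    have h2 : 1 / 5.8224 < 1 / alpha 9 := one_div_lt_one_div_of_lt h9 alpha_nine_lt
    refine le_max_of_le_right (max_le ?_ ?_)
    · norm_num at h2 ⊢; norm_num at h1; linarith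
    · linarith
  · have hk8 : (k : ℝ) ≤ 8 := by exact_mod_cast Nat.lt_succ_iff.1 h
    have h1 : (1 : ℝ) / 8 ≤ 1 / k := one_div_le_one_div_of_le hk0' hk8
    have h2 : 1 / alpha 9 ≤ 1 / (16 / 3) := one_div_le_one_div_of_le (by norm_num) le_alpha_nine
    refine le_max_of_le_left (max_le (by linarith) ?_)
    norm_num at h2 ⊢; norm_num at h1; linarith

lemma lt_max_nine : (0.1145 : ℝ) < max (1 / 9) (1 / alpha 9 * (1 - 1 / 3)) := by
  have h9 : (0 : ℝ) < alpha 9 := by linarith [le_alpha_nine]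
  have h2 : 1 / 5.8224 < 1 / alpha 9 := one_div_lt_one_div_of_lt h9 alpha_nine_lt
  refine lt_max_of_lt_right ?_
  norm_num at h2 ⊢; linarith

/-! ### Random subsets -/

section Sampled

variable {Ω : Type*} [DecidableEq Ω] {p : ℝ} {f h : Finset Ω → ℝ} {A T : Finset Ω} {u x : Ω}

@[simp] lemma sampled_empty (p : ℝ) (f : Finset Ω → ℝ) : sampled p f ∅ = f ∅ := by
  simp [sampled]

lemma sampled_insert (p : ℝ) (f : Finset Ω → ℝ) (hu : u ∉ A) :
    sampled p f (insert u A)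
      = (1 - p) * sampled p f A + p * sampled p (fun T => f (insert u T)) A := by
  unfold sampled
  rw [sum_powerset_insert hu, mul_sum, mul_sum]
  congr 1 <;> refine sum_congr rfl fun T hT => ?_
  · rw [mem_powerset] at hT
    have huT : u ∉ T := fun h => hu (hT h)
    rw [insert_sdiff_of_notMem _ huT, card_insert_of_notMem (by simp [hu]), pow_succ]
    ring
  · rw [mem_powerset] at hT
    have huT : u ∉ T := fun h => hu (hT h)
    rw [insert_sdiff_insert, sdiff_insert_of_notMem hu, card_insert_of_notMem huT, pow_succ]
    ring

lemma sampled_sub (p : ℝ) (f h : Finset Ω → ℝ) (A : Finset Ω) :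
    sampled p (fun T => f T - h T) A = sampled p f A - sampled p h A := by
  simp only [sampled, mul_sub, sum_sub_distrib]

lemma sampled_add (p : ℝ) (f h : Finset Ω → ℝ) (A : Finset Ω) :
    sampled p (fun T => f T + h T) A = sampled p f A + sampled p h A := by
  simp only [sampled, mul_add, sum_add_distrib]

lemma sampled_sum {ι : Type*} (p : ℝ) (s : Finset ι) (f : ι → Finset Ω → ℝ) (A : Finset Ω) :
    sampled p (fun T => ∑ i ∈ s, f i T) A = ∑ i ∈ s, sampled p (f i) A := by
  simp only [sampled, mul_sum]
  exact sum_comm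

lemma sampled_mono (hp0 : 0 ≤ p) (hp1 : p ≤ 1) (hfh : ∀ T ⊆ A, f T ≤ h T) :
    sampled p f A ≤ sampled p h A := by
  have : 0 ≤ 1 - p := sub_nonneg.2 hp1
  exact sum_le_sum fun T hT => mul_le_mul_of_nonneg_left (hfh T (mem_powerset.1 hT)) (by positivity)

lemma sampled_congr (hfh : ∀ T ⊆ A, f T = h T) : sampled p f A = sampled p h A :=
  sum_congr rfl fun T hT => by rw [hfh T (mem_powerset.1 hT)]

lemma sampled_union (p : ℝ) (f : Finset Ω → ℝ) {A B : Finset Ω} (hAB : Disjoint A B) :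
    sampled p f (A ∪ B) = sampled p (fun X => sampled p (fun Y => f (X ∪ Y)) B) A := by
  induction A using Finset.induction_on generalizing f with
  | empty => simp
  | insert a A ha ih =>
    rw [disjoint_insert_left] at hAB
    rw [insert_union, sampled_insert p f (by simp [ha, hAB.1]), sampled_insert p _ ha,
      ih _ hAB.2, ih _ hAB.2]
    simp only [insert_union]

/-! ### Submodularity under random sampling. -/

lemma IsSubmodular.union_left (hf : IsSubmodular f) (B : Finset Ω) :
    IsSubmodular fun T => f (B ∪ T) := by
  intro S T
  have := hf (B ∪ S) (B ∪ T)
  rwa [← union_union_distrib_left, ← union_inter_distrib_left] at this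

lemma IsSubmodular.insert_left (hf : IsSubmodular f) (u : Ω) :
    IsSubmodular fun T => f (insert u T) := hf.union_left {u}

lemma IsSubmodular.insert_insert_add_le (hf : IsSubmodular f) (hux : u ≠ x) (T : Finset Ω) :
    f (insert u (insert x T)) + f T ≤ f (insert x T) + f (insert u T) := by
  have := hf (insert x T) (insert u T)
  have e1 : insert x T ∪ insert u T = insert u (insert x T) := by
    grind
  have e2 : insert x T ∩ insert u T = T := by
    ext a; simp only [mem_inter, mem_insert]
    refine ⟨?_, fun h => ⟨.inr h, .inr h⟩⟩
    rintro ⟨rfl | h, h' | h'⟩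
    exacts [absurd h'.symm hux, h', h, h]
  rwa [e1, e2] at this

lemma sampled_isSubmodular_right {g : Finset Ω → Finset Ω → ℝ} (hp0 : 0 ≤ p) (hp1 : p ≤ 1)
    (hg : ∀ T, IsSubmodular fun X => g X T) (A : Finset Ω) :
    IsSubmodular fun X => sampled p (g X) A := by
  intro S T
  simp only [← sampled_add]
  exact sampled_mono hp0 hp1 fun Y _ => hg Y S T

/-- Conditioning on whether u and x are sampled shows that the mixed second difference is p² times
the sampled second difference of f. -/
lemma IsSubmodular.sampled_insert_insert_add_le (hf : IsSubmodular f) (hp0 : 0 ≤ p) (hp1 : p ≤ 1)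
    (hux : u ≠ x) (hu : u ∉ A) (hx : x ∉ A) :
    sampled p f (insert u (insert x A)) + sampled p f A
      ≤ sampled p f (insert x A) + sampled p f (insert u A) := by
  rw [sampled_insert p f (by simp [hu, hux]), sampled_insert p f hx, sampled_insert p _ hx,
    sampled_insert p f hu]
  have h := sampled_mono hp0 hp1 (A := A) fun T _ => hf.insert_insert_add_le hux T
  rw [sampled_add, sampled_add] at h
  nlinarith [mul_nonneg hp0 hp0]

/-- The marginals of `sampled p f` are antitone. -/
lemma IsSubmodular.sampled_marginal_anti (hf : IsSubmodular f) (hp0 : 0 ≤ p) (hp1 : p ≤ 1)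
    (hTA : T ⊆ A) (hu : u ∉ A) :
    sampled p f (insert u A) - sampled p f A
      ≤ sampled p f (insert u T) - sampled p f T := by
  induction A using Finset.induction_on generalizing f T with
  | empty => rw [subset_empty.1 hTA]
  | insert a A ha ih =>
    rw [mem_insert, not_or] at hu
    by_cases haT : a ∈ T
    · obtain ⟨T, haT', rfl⟩ : ∃ T', a ∉ T' ∧ insert a T' = T :=
        ⟨T.erase a, notMem_erase a T, insert_erase haT⟩
      have hT : T ⊆ A := (insert_subset_insert_iff haT').1 hTA
      have huT : u ∉ T := fun h => hu.2 (hT h)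
      have h1 := mul_le_mul_of_nonneg_left (ih hf hT hu.2) (sub_nonneg.2 hp1)
      have h2 := mul_le_mul_of_nonneg_left (ih (hf.insert_left a) hT hu.2) hp0
      rw [insert_comm u a A, insert_comm u a T, sampled_insert p f ha, sampled_insert p f haT',
        sampled_insert p f (A := insert u A) (by simp [ha, Ne.symm hu.1]),
        sampled_insert p f (A := insert u T) (by simp [haT', Ne.symm hu.1])]
      linarith
    · have := ih hf ((subset_insert_iff_of_notMem haT).1 hTA) hu.2
      have key := hf.sampled_insert_insert_add_le hp0 hp1 hu.1 hu.2 ha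
      linarith

/-- Conditioning on a gives two inductive bounds, merged by f({a}) + f(A) ≥ f(A ∪ {a}) + f(∅).
Applied to f(O ∪ ·), with nonnegativity in place of monotonicity, it produces the factor 1 - 1/ρ. -/
lemma IsSubmodular.le_sampled (hf : IsSubmodular f) (hp0 : 0 ≤ p) (hp1 : p ≤ 1) (A : Finset Ω) :
    (1 - p) * f ∅ + p * f A ≤ sampled p f A := by
  induction A using Finset.induction_on generalizing f with
  | empty => simp; linarith
  | insert a A ha ih =>
    rw [sampled_insert p f ha]
    have h1 := mul_le_mul_of_nonneg_left (ih hf) (sub_nonneg.2 hp1)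
    have h2 := mul_le_mul_of_nonneg_left (ih (hf.insert_left a)) hp0
    have h3 := hf {a} A
    rw [singleton_inter_of_notMem ha, singleton_union] at h3
    have h4 := mul_le_mul_of_nonneg_left h3 (mul_nonneg hp0 (sub_nonneg.2 hp1))
    simp only [insert_empty_eq] at h2
    nlinarith

lemma IsSubmodular.union_sub_le (hf : IsSubmodular f) (T O : Finset Ω) :
    f (T ∪ O) - f T ≤ ∑ u ∈ O, (f (insert u T) - f T) := by
  induction O using Finset.induction_on with
  | empty => simp
  | insert a O ha ih =>
    rw [sum_insert ha]
    by_cases haT : a ∈ T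
    · rw [insert_eq_self.2 haT, union_insert, insert_eq_self.2 (mem_union_left _ haT)]
      linarith
    · have h := hf (insert a T) (T ∪ O)
      have e1 : insert a T ∪ (T ∪ O) = T ∪ insert a O := by grind
      have e2 : insert a T ∩ (T ∪ O) = T := by
        rw [insert_inter_of_notMem (by simp [haT, ha]), inter_eq_left.2 subset_union_left]
      rw [e1, e2] at h
      linarith

/-- A marginal over a random set is at most the marginal over ∅. For a block of three slots and p =
1/3 the right side becomes the average over the slots. -/
lemma IsSubmodular.sampled_le (hf : IsSubmodular f) (hp0 : 0 ≤ p) (hp1 : p ≤ 1) (A : Finset Ω) :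
    sampled p f A ≤ f ∅ + p * ∑ a ∈ A, (f {a} - f ∅) := by
  induction A using Finset.induction_on generalizing f with
  | empty => simp
  | insert a A ha ih =>
    rw [sampled_insert p f ha, sum_insert ha]
    have h1 := ih hf
    have h2 : sampled p (fun T => f (insert a T)) A ≤ sampled p f A + (f {a} - f ∅) := by
      have : sampled p (fun _ => f {a} - f ∅) A = f {a} - f ∅ := by
        clear ih h1
        induction A using Finset.induction_on with
        | empty => simp
        | insert b A hb ih =>
          rw [sampled_insert p _ hb, ih (fun h => ha (mem_insert_of_mem h))]; ring
      rw [← this, ← sampled_add]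
      refine sampled_mono hp0 hp1 fun T hT => ?_
      have h3 := hf {a} T
      rw [singleton_inter_of_notMem fun h => ha (hT h), singleton_union] at h3
      linarith
    nlinarith [mul_le_mul_of_nonneg_left h2 hp0]

/-- The random set that contains one uniformly chosen slot from each block is at least as good as
an independent sample of all slots. -/
lemma IsSubmodular.sampled_le_average (k : ℕ) (hf : IsSubmodular f)
    (sl : Fin k × Fin 3 → Option Ω)
    (hsl : ∀ i j v, sl i = some v → sl j = some v → i = j) :
    sampled (1 / 3) f (univ.biUnion fun j => (sl j).toFinset)
      ≤ (1 / 3) ^ k * ∑ c : Fin k → Fin 3, f (univ.biUnion fun i => (sl (i, c i)).toFinset) := by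
  induction k generalizing f with
  | zero => simp
  | succ k ih =>
    set sl' : Fin k × Fin 3 → Option Ω := fun j => sl (j.1.succ, j.2) with hsl'
    set S' := univ.biUnion fun j => (sl' j).toFinset with hS'
    set S0 := univ.biUnion fun c => (sl (0, c)).toFinset with hS0
    have hdisj : Disjoint S0 S' := by
      rw [Finset.disjoint_left]
      intro v h1 h2
      simp only [hS0, hS', mem_biUnion, mem_univ, true_and, Option.mem_toFinset, Option.mem_def] at h1 h2
      obtain ⟨c, hc⟩ := h1
      obtain ⟨j, hj⟩ := h2
      have := hsl _ _ _ hc hj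
      exact absurd (congrArg Prod.fst this) (Fin.succ_ne_zero _).symm
    have hU : (univ.biUnion fun j => (sl j).toFinset) = S0 ∪ S' := by
      ext v
      simp [hS0, hS', hsl', Prod.exists, Fin.exists_fin_succ]
    have hc : ∀ c0 : Fin 3, ∀ c : Fin k → Fin 3,
        (univ.biUnion fun i => (sl (i, (Fin.cons c0 c : Fin (k + 1) → Fin 3) i)).toFinset)
          = (sl (0, c0)).toFinset ∪ univ.biUnion fun i => (sl' (i, c i)).toFinset := by
      intro c0 c
      ext v
      simp [hsl', Fin.exists_fin_succ]
    rw [hU, sampled_union _ _ hdisj, ← (Fin.consEquiv fun _ => Fin 3).sum_comp, Fintype.sum_prod_type]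
    simp only [Fin.consEquiv_apply, hc]
    -- G fixes the part X from the first block and samples the remaining blocks; the induction
    -- hypothesis bounds G at each slot of the first block.
    set G : Finset Ω → ℝ := fun X => sampled (1 / 3) (fun Y => f (X ∪ Y)) S' with hG
    have hGs : IsSubmodular G := by
      refine sampled_isSubmodular_right (by norm_num) (by norm_num) (fun T => ?_) S'
      simpa only [union_comm T] using hf.union_left T
    have h1 : ∀ c0 : Fin 3, G (sl (0, c0)).toFinset ≤ (1 / 3) ^ k * ∑ c : Fin k → Fin 3,
        f ((sl (0, c0)).toFinset ∪ univ.biUnion fun i => (sl' (i, c i)).toFinset) := fun c0 =>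
      ih (hf.union_left _) sl' fun i j v hi hj => by
        have := hsl _ _ _ hi hj
        rw [Prod.mk.injEq, Fin.succ_inj] at this
        exact Prod.ext this.1 this.2
    have h2 := sum_le_sum fun c0 (_ : c0 ∈ univ) => h1 c0
    rw [← mul_sum] at h2
    have h3 := hGs.sampled_le (p := 1 / 3) (by norm_num) (by norm_num) S0
    -- An empty slot contributes G ∅ - G ∅ = 0, so partially filled blocks need no separate
    -- treatment.
    have h4 : ∑ a ∈ S0, (G {a} - G ∅) = ∑ c : Fin 3, (G (sl (0, c)).toFinset - G ∅) := by
      rw [hS0, sum_biUnion]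
      · refine sum_congr rfl fun c _ => ?_
        cases sl (0, c) <;> simp
      · intro c _ d _ hcd
        rw [Function.onFun, Finset.disjoint_left]
        intro v hv hv'
        simp only [Option.mem_toFinset, Option.mem_def] at hv hv'
        exact hcd (congrArg Prod.snd (hsl _ _ _ hv hv'))
    rw [h4, sum_sub_distrib] at h3
    simp only [sum_const, card_univ, Fintype.card_fin, nsmul_eq_mul] at h3
    rw [pow_succ]
    push_cast at h3
    linarith

end Sampled
/-! ### The potential -/

section Potential

/-- The potential `∑ i, q ^ (n - i) * x i` of a list `x 0, …, x (n - 1)`. -/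
def potential (q : ℝ) : List ℝ → ℝ
  | [] => 0
  | x :: L => q ^ (L.length + 1) * x + potential q L

variable {q m : ℝ} {L L₁ L₂ : List ℝ}

/-- A new last entry raises every earlier exponent by one. -/
lemma potential_append_singleton (q x : ℝ) (L : List ℝ) :
    potential q (L ++ [x]) = q * (potential q L + x) := by
  induction L with
  | nil => simp [potential]
  | cons y L ih =>
    simp only [List.cons_append, potential, ih, List.length_append, List.length_singleton]
    ring

/-- Rearrangement: at the front, m takes the largest coefficient, and the entries it passes, none
smaller, drop one power of q. -/
lemma potential_cons_append_le (hq : 1 ≤ q) (h : ∀ y ∈ L₁, m ≤ y) :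
    potential q (m :: (L₁ ++ L₂)) ≤ potential q (L₁ ++ m :: L₂) := by
  induction L₁ with
  | nil => rfl
  | cons y L₁ ih =>
    have h1 := ih fun z hz => h z (List.mem_cons_of_mem _ hz)
    have hy : m ≤ y := h y List.mem_cons_self
    simp only [potential, List.cons_append, List.length_cons, List.length_append] at h1 ⊢
    set n := L₁.length + L₂.length
    have e : L₁.length + (L₂.length + 1) + 1 = n + 2 := by omega
    rw [e]
    have h2 : (0 : ℝ) ≤ q ^ (n + 1) * (q - 1) * (y - m) :=
      mul_nonneg (mul_nonneg (by positivity) (sub_nonneg.2 hq)) (sub_nonneg.2 hy)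
    have e2 : q ^ (n + 1 + 1) = q ^ (n + 1) * q := pow_succ _ _
    rw [show n + 2 = n + 1 + 1 from rfl, e2]
    nlinarith

/-- All entries are at least m, and the coefficients form a geometric sum; the factor q - 1 is kept
on the right so that q = 1 is allowed. -/
lemma mul_le_potential (hq : 1 ≤ q) (h : ∀ y ∈ L, m ≤ y) :
    (q ^ (L.length + 1) - q) * m ≤ (q - 1) * potential q L := by
  induction L with
  | nil => simp [potential]
  | cons y L ih =>
    have h1 := ih fun z hz => h z (List.mem_cons_of_mem _ hz)
    have hy : m ≤ y := h y List.mem_cons_self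
    simp only [potential, List.length_cons]
    have h2 : (0 : ℝ) ≤ (q - 1) * q ^ (L.length + 1) * (y - m) :=
      mul_nonneg (mul_nonneg (sub_nonneg.2 hq) (by positivity)) (sub_nonneg.2 hy)
    rw [pow_succ q (L.length + 1)]
    nlinarith

lemma length_mul_le_potential (hq : 1 ≤ q) (hm : 0 ≤ m) (h : ∀ y ∈ L, m ≤ y) :
    L.length * m ≤ potential q L := by
  induction L with
  | nil => simp [potential]
  | cons y L ih =>
    have h1 := ih fun z hz => h z (List.mem_cons_of_mem _ hz)
    have hy : m ≤ y := h y List.mem_cons_self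
    simp only [potential, List.length_cons]
    have h2 : 1 * m ≤ q ^ (L.length + 1) * y :=
      mul_le_mul (one_le_pow₀ hq) hy hm (by positivity)
    push_cast; linarith

lemma potential_nonneg (hq : 1 ≤ q) (h : ∀ y ∈ L, 0 ≤ y) : 0 ≤ potential q L := by
  simpa using length_mul_le_potential hq le_rfl h

lemma potential_replicate_zero (q : ℝ) (n : ℕ) : potential q (List.replicate n 0) = 0 := by
  induction n with
  | zero => rfl
  | succ n ih => simp [List.replicate_succ, potential, ih]

/-- If the minimum `m` is replaced by a number `x` above the threshold `Φ / n`, then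
`Φ` grows, and it keeps dominating the potential. -/
lemma potential_replace {n : ℕ} {a Φ x : ℝ} (hn : 0 < n) (hq : 1 ≤ q) (ha : a = q ^ (n + 1))
    (hb : a - 3 = n * (q - 1) + q) (hlen : (L₁ ++ m :: L₂).length = n) (hm : 0 ≤ m)
    (hmin : ∀ y ∈ L₁ ++ m :: L₂, m ≤ y) (hΦ : potential q (L₁ ++ m :: L₂) ≤ Φ)
    (hx : Φ ≤ n * x) :
    Φ ≤ Φ + (a - 3) * x - a * m ∧
      potential q (L₁ ++ L₂ ++ [x]) ≤ Φ + (a - 3) * x - a * m := by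
  have hn' : (0 : ℝ) < n := Nat.cast_pos.2 hn
  have h1 := length_mul_le_potential hq hm hmin
  have h2 := mul_le_potential hq hmin
  rw [hlen] at h1 h2
  rw [← ha] at h2
  have hmx : m ≤ x := le_of_mul_le_mul_left (h1.trans (hΦ.trans hx)) hn'
  have h3 := potential_cons_append_le (L₂ := L₂) hq
    fun y hy => hmin y (List.mem_append_left _ hy)
  have h4 : (L₁ ++ L₂).length + 1 = n := by
    rw [← hlen]; simp only [List.length_append, List.length_cons]; omega
  -- The acceptance condition pays for the growth of the older entries: qΦ + qx ≤ Φ + (n(q - 1) +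
  -- q)x.
  have h5 : (q - 1) * Φ ≤ (q - 1) * (n * x) := mul_le_mul_of_nonneg_left hx (sub_nonneg.2 hq)
  have h6 := mul_le_mul_of_nonneg_left hΦ (sub_nonneg.2 hq)
  have hq0 : 0 ≤ q := by linarith
  rw [hb]
  constructor
  · nlinarith [mul_le_mul_of_nonneg_left hmx hq0]
  · rw [potential_append_singleton]
    simp only [potential, h4] at h3
    have h7 := mul_le_mul_of_nonneg_left (h3.trans hΦ) hq0
    have h8 : a * m = q * (q ^ n * m) := by rw [ha, pow_succ]; ring
    rw [h8]
    linarith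

end Potential

/-! ### The best-singleton algorithm -/

/-- The set held by the best-singleton algorithm. -/
noncomputable def bestSingleton {Ω : Type*} (f : Finset Ω → ℝ) (l : List Ω) : Finset Ω :=
  l.foldl (fun S u => if f S < f {u} then {u} else S) ∅

lemma bestSingleton_append {Ω : Type*} (f : Finset Ω → ℝ) (l : List Ω) (u : Ω) :
    bestSingleton f (l ++ [u])
      = if f (bestSingleton f l) < f {u} then {u} else bestSingleton f l := by
  rw [bestSingleton, List.foldl_append]
  rfl

section Singleton

variable {Ω : Type*} [DecidableEq Ω]

/-- For nonempty O, f(O) ≤ ∑ f({u}) - (|O| - 1) f(∅), and the last term is dropped because f(∅) ≥ 0.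
For empty O, k ≥ 1 is needed. -/
lemma IsSubmodular.le_of_singleton_le {f : Finset Ω → ℝ} (hf : IsSubmodular f)
    (h0 : ∀ S, 0 ≤ f S) {k : ℕ} (hk : 1 ≤ k) {O : Finset Ω} (hO : O.card ≤ k) {b : ℝ}
    (hb0 : f ∅ ≤ b) (hb : ∀ u ∈ O, f {u} ≤ b) : f O ≤ k * b := by
  have hb' : 0 ≤ b := (h0 ∅).trans hb0
  rcases O.eq_empty_or_nonempty with rfl | hne
  · have : (1 : ℝ) ≤ k := by exact_mod_cast hk
    nlinarith
  · have h := hf.union_sub_le ∅ O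
    simp only [empty_union, insert_empty_eq, sum_sub_distrib, sum_const, nsmul_eq_mul] at h
    have h1 : ∑ u ∈ O, f {u} ≤ O.card * b := by
      simpa using sum_le_card_nsmul O (fun u => f {u}) b hb
    have h2 : (1 : ℝ) ≤ O.card := by exact_mod_cast hne.card_pos
    have h3 : (O.card : ℝ) ≤ k := by exact_mod_cast hO
    nlinarith [h0 ∅]

lemma exists_optValue_eq (k : ℕ) (f : Finset Ω → ℝ) (l : List Ω) :
    ∃ O ⊆ l.toFinset, O.card ≤ k ∧ optValue k f l = f O := by
  obtain ⟨O, hO, h⟩ := exists_mem_eq_sup' (s := l.toFinset.powerset.filter fun S => S.card ≤ k)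
    ⟨∅, by simp⟩ f
  rw [mem_filter, mem_powerset] at hO
  exact ⟨O, hO.1, hO.2, h⟩

lemma optValue_nonneg {k : ℕ} {f : Finset Ω → ℝ} (h0 : ∀ S, 0 ≤ f S) (l : List Ω) :
    0 ≤ optValue k f l := by
  obtain ⟨O, -, -, h⟩ := exists_optValue_eq k f l
  rw [h]; exact h0 O

lemma RandAlg.HasCompetitiveRatio.mono {k : ℕ} {alg : RandAlg Ω} {r r' : ℝ}
    (h : alg.HasCompetitiveRatio k r) (hr : r' ≤ r) : alg.HasCompetitiveRatio k r' :=
  fun f h0 hf l hl =>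
    (mul_le_mul_of_nonneg_right hr (optValue_nonneg h0 l)).trans (h f h0 hf l hl)

lemma bestSingleton_spec (f : Finset Ω → ℝ) (l : List Ω) :
    bestSingleton f l ⊆ l.toFinset ∧ (bestSingleton f l).card ≤ 1 ∧
      f ∅ ≤ f (bestSingleton f l) ∧ ∀ u ∈ l, f {u} ≤ f (bestSingleton f l) := by
  induction l using List.reverseRecOn with
  | nil => simp [bestSingleton]
  | append_singleton l u ih =>
    obtain ⟨h1, h2, h3, h4⟩ := ih
    rw [bestSingleton_append]
    split_ifs with h
    · refine ⟨by simp, by simp, h3.trans h.le, fun v hv => ?_⟩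
      rcases List.mem_append.1 hv with hv | hv
      · exact (h4 v hv).trans h.le
      · rw [List.mem_singleton.1 hv]
    · refine ⟨h1.trans (by simp), h2, h3, fun v hv => ?_⟩
      rcases List.mem_append.1 hv with hv | hv
      · exact h4 v hv
      · rw [List.mem_singleton.1 hv]; exact not_lt.1 h

lemma singletonAlg_isOnline {k : ℕ} (hk : 1 ≤ k) : (singletonAlg Ω).IsOnline k where
  start _ _ := rfl
  round _ f l u := by
    change bestSingleton f (l ++ [u]) ⊆ insert u (bestSingleton f l)
    rw [bestSingleton_append]
    split_ifs
    · simp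
    · exact subset_insert _ _
  feasible _ f l := (bestSingleton_spec f l).2.1.trans hk
  oracle _ f f' l := by
    change _ → bestSingleton f l = bestSingleton f' l
    induction l using List.reverseRecOn with
    | nil => intro _; rfl
    | append_singleton l u ih =>
      intro h
      have hl : l.toFinset ⊆ (l ++ [u]).toFinset := by simp
      rw [bestSingleton_append, bestSingleton_append, ← ih fun T hT => h T (hT.trans hl),
        h _ ((bestSingleton_spec f l).1.trans hl), h {u} (by simp)]

lemma singletonAlg_hasCompetitiveRatio {k : ℕ} (hk : 1 ≤ k) :
    (singletonAlg Ω).HasCompetitiveRatio k (1 / (k : ℝ)) := by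
  intro f h0 hf l _
  obtain ⟨O, hOl, hOk, hO⟩ := exists_optValue_eq k f l
  have hk0 : (0 : ℝ) < k := by exact_mod_cast hk
  have e : (singletonAlg Ω).expValue f l = f (bestSingleton f l) := by
    change ∑ r : Unit, ((PMF.pure () : PMF Unit) r).toReal * f (bestSingleton f l) = _
    simp
  obtain ⟨-, -, h3, h4⟩ := bestSingleton_spec f l
  rw [hO, e, one_div, inv_mul_le_iff₀ hk0]
  exact hf.le_of_singleton_le h0 hk hOk h3 fun u hu => h4 u (List.mem_toFinset.1 (hOl hu))

end Singleton
/-! ### The modified algorithm -/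

/-- This keeps the quantification over slot rules from being vacuous. -/
lemma nonempty_slotRule {Ω : Type*} {k : ℕ} (hk : 1 ≤ k) : Nonempty (SlotRule Ω k) := by
  have : Nonempty (Fin k × Fin 3) := ⟨(⟨0, hk⟩, 0)⟩
  have h : ∀ s : State Ω k, ∃ j, ((∃ j, s.slots j = none) → s.slots j = none) ∧
      ((∀ j, s.slots j ≠ none) →
        ∀ v, s.slots j = some v → ∀ j v', s.slots j = some v' → s.w v ≤ s.w v') := by
    intro s
    by_cases hs : ∃ j, s.slots j = none
    · obtain ⟨j, hj⟩ := hs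
      exact ⟨j, fun _ => hj, fun h => absurd hj (h j)⟩
    · obtain ⟨j, hj⟩ := Finite.exists_min fun j => (s.slots j).elim 0 s.w
      refine ⟨j, fun h => absurd h hs, fun _ v hv i v' hv' => ?_⟩
      simpa [hv, hv'] using hj i
  choose slot h1 h2 using h
  exact ⟨⟨slot, h1, h2⟩⟩

section Modified

variable {Ω : Type*} [DecidableEq Ω] {k : ℕ}

/-- The weight of the content of a slot, where an empty slot has weight `0`. -/
def State.slotWeight (s : State Ω k) (j : Fin k × Fin 3) : ℝ := (s.slots j).elim 0 s.w

/-- The quantity `α_k w(S) - 3 w(A)` that determines the acceptance threshold. -/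
noncomputable def State.threshold (s : State Ω k) : ℝ :=
  alpha k * ∑ v ∈ s.S, s.w v - 3 * ∑ v ∈ s.A, s.w v

/-- The state after `u` has been accepted with weight `x`. -/
noncomputable def State.accept (rule : SlotRule Ω k) (s : State Ω k) (u : Ω) (x : ℝ) :
    State Ω k where
  slots := Function.update s.slots (rule.slot s) (some u)
  A := insert u s.A
  w := Function.update s.w u x

lemma step_eq (rule : SlotRule Ω k) (f : Finset Ω → ℝ) (s : State Ω k) (u : Ω) :
    step rule f s u
      = if 1 / (3 * (k : ℝ)) * s.threshold < sampled (1 / 3) f (insert u s.A) - sampled (1 / 3) f s.A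
        then s.accept rule u (sampled (1 / 3) f (insert u s.A) - sampled (1 / 3) f s.A) else s :=
  rfl

lemma run_append (rule : SlotRule Ω k) (f : Finset Ω → ℝ) (l : List Ω) (u : Ω) :
    run rule f (l ++ [u]) = step rule f (run rule f l) u := by
  simp [run, List.foldl_append]

lemma run_A_subset (rule : SlotRule Ω k) (f : Finset Ω → ℝ) (l : List Ω) :
    (run rule f l).A ⊆ l.toFinset := by
  induction l using List.reverseRecOn with
  | nil => simp [run]
  | append_singleton l u ih =>
    rw [run_append, step_eq]
    split_ifs
    · exact (insert_subset_insert u ih).trans (by intro; simp)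
    · exact ih.trans (by simp)

/-- Each round evaluates f only on subsets of A ∪ {u}, all of whose elements have arrived. -/
lemma run_congr (rule : SlotRule Ω k) {f f' : Finset Ω → ℝ} {l : List Ω}
    (h : ∀ T, T ⊆ l.toFinset → f T = f' T) : run rule f l = run rule f' l := by
  induction l using List.reverseRecOn with
  | nil => rfl
  | append_singleton l u ih =>
    have hl : insert u l.toFinset = (l ++ [u]).toFinset := by ext; simp
    have hA := run_A_subset rule f l
    rw [← hl] at h
    have e : ∀ B, B ⊆ insert u l.toFinset → sampled (1 / 3) f B = sampled (1 / 3) f' B :=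
      fun B hB => sampled_congr fun T hT => h T (hT.trans hB)
    rw [run_append, run_append, ← ih fun T hT => h T (hT.trans (subset_insert _ _)), step_eq,
      step_eq, e _ (insert_subset_insert u hA), e _ (hA.trans (subset_insert _ _))]

lemma modifiedAlg_isOnline (rule : SlotRule Ω k) : (modifiedAlg rule).IsOnline k where
  start c f := by
    ext
    simp [modifiedAlg, run]
  round c f l u := by
    change (univ.biUnion fun i => ((run rule f (l ++ [u])).slots (i, c i)).toFinset)
      ⊆ insert u (univ.biUnion fun i => ((run rule f l).slots (i, c i)).toFinset)
    rw [run_append, step_eq]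
    split_ifs
    · intro v hv
      simp only [State.accept, mem_biUnion, mem_univ, true_and, Option.mem_toFinset,
        Option.mem_def, mem_insert] at hv ⊢
      obtain ⟨i, hi⟩ := hv
      rw [Function.update_apply] at hi
      split_ifs at hi
      · exact .inl (Option.some_injective _ hi).symm
      · exact .inr ⟨i, hi⟩
    · exact subset_insert _ _
  feasible c f l := by
    refine card_biUnion_le.trans ((sum_le_card_nsmul _ _ 1 fun i _ => ?_).trans (by simp))
    cases (run rule f l).slots (i, c i) <;> simp
  oracle c f f' l h := by
    change (univ.biUnion fun i => ((run rule f l).slots (i, c i)).toFinset)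
      = univ.biUnion fun i => ((run rule f' l).slots (i, c i)).toFinset
    rw [run_congr rule h]

lemma modifiedAlg_expValue (rule : SlotRule Ω k) (f : Finset Ω → ℝ) (l : List Ω) :
    (modifiedAlg rule).expValue f l = (1 / 3) ^ k * ∑ c : Fin k → Fin 3,
      f (univ.biUnion fun i => ((run rule f l).slots (i, c i)).toFinset) := by
  rw [mul_sum]
  change ∑ c : Fin k → Fin 3, ((PMF.uniformOfFintype (Fin k → Fin 3)) c).toReal * _ = _
  refine sum_congr rfl fun c _ => ?_
  simp [modifiedAlg]

/-- No element occupies two slots. -/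
def State.SlotsInj (s : State Ω k) : Prop :=
  ∀ i j v, s.slots i = some v → s.slots j = some v → i = j

lemma State.SlotsInj.sum_S {s : State Ω k} (hs : s.SlotsInj) :
    ∑ v ∈ s.S, s.w v = ∑ j, s.slotWeight j := by
  rw [State.S, sum_biUnion]
  · refine sum_congr rfl fun j _ => ?_
    rw [State.slotWeight]
    cases s.slots j <;> simp
  · intro i _ j _ hij
    rw [Function.onFun, Finset.disjoint_left]
    intro v hv hv'
    simp only [Option.mem_toFinset, Option.mem_def] at hv hv'
    exact hij (hs _ _ _ hv hv')

/-- What holds for the state `s` of the modified algorithm after the elements of `l`. -/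
structure State.Invariant (f : Finset Ω → ℝ) (q : ℝ) (s : State Ω k) (l : List Ω) : Prop where
  A_subset : s.A ⊆ l.toFinset
  mem_A : ∀ j v, s.slots j = some v → v ∈ s.A
  slotsInj : s.SlotsInj
  w_nonneg : ∀ v ∈ s.A, 0 ≤ s.w v
  sum_w : ∑ v ∈ s.A, s.w v = sampled (1 / 3) f s.A - f ∅
  le_sampled : ∀ T ⊆ s.A, f ∅ + ∑ v ∈ T, s.w v ≤ sampled (1 / 3) f T
  marginal_le : ∀ v ∈ s.A, sampled (1 / 3) f s.A - sampled (1 / 3) f (s.A.erase v) ≤ s.w v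
  rejected : ∀ u ∈ l, u ∉ s.A →
    3 * k * (sampled (1 / 3) f (insert u s.A) - sampled (1 / 3) f s.A) ≤ s.threshold
  potential_le : ∃ L : List ℝ, (L : Multiset ℝ) = univ.val.map s.slotWeight ∧
    potential q L ≤ s.threshold

/-! ### Preservation of the invariant. -/

namespace State.Invariant

variable {f : Finset Ω → ℝ} {q : ℝ} {s : State Ω k} {l : List Ω} {u : Ω}

lemma slotWeight_nonneg (hs : s.Invariant f q l) (j : Fin k × Fin 3) : 0 ≤ s.slotWeight j := by
  rw [State.slotWeight]
  cases h : s.slots j with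
  | none => exact le_rfl
  | some v => exact hs.w_nonneg v (hs.mem_A j v h)

/-- An empty slot has weight 0, the least possible, so filling it counts as replacing a minimum and
needs no case of its own. -/
lemma slotWeight_slot_le (hs : s.Invariant f q l) (rule : SlotRule Ω k) (j : Fin k × Fin 3) :
    s.slotWeight (rule.slot s) ≤ s.slotWeight j := by
  by_cases h : ∃ j, s.slots j = none
  · have : s.slotWeight (rule.slot s) = 0 := by simp [State.slotWeight, rule.slot_empty s h]
    rw [this]
    exact hs.slotWeight_nonneg j
  · push Not at h
    obtain ⟨v, hv⟩ := Option.ne_none_iff_exists'.1 (h (rule.slot s))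
    obtain ⟨v', hv'⟩ := Option.ne_none_iff_exists'.1 (h j)
    simpa [State.slotWeight, hv, hv'] using rule.slot_argmin s h v hv j v' hv'

lemma threshold_nonneg (hs : s.Invariant f q l) (hq : 1 ≤ q) : 0 ≤ s.threshold := by
  obtain ⟨L, hL, h⟩ := hs.potential_le
  refine (potential_nonneg hq fun y hy => ?_).trans h
  rw [← Multiset.mem_coe, hL, Multiset.mem_map] at hy
  obtain ⟨j, -, rfl⟩ := hy
  exact hs.slotWeight_nonneg j

lemma slotWeight_accept (hs : s.Invariant f q l) (rule : SlotRule Ω k) (hu : u ∉ s.A) (x : ℝ) :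
    (s.accept rule u x).slotWeight = Function.update s.slotWeight (rule.slot s) x := by
  funext j
  by_cases hj : j = rule.slot s
  · subst hj; simp [State.slotWeight, State.accept]
  · simp only [State.slotWeight, State.accept, Function.update_of_ne hj]
    cases h : s.slots j with
    | none => rfl
    | some v =>
      have : v ≠ u := fun e => hu (e ▸ hs.mem_A j v h)
      simp [this]

lemma slotsInj_accept (hs : s.Invariant f q l) (rule : SlotRule Ω k) (hu : u ∉ s.A) (x : ℝ) :
    (s.accept rule u x).SlotsInj := by
  intro i j v hi hj
  simp only [State.accept, Function.update_apply] at hi hj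
  split_ifs at hi hj with h1 h2 h2
  · rw [h1, h2]
  · exact absurd (hs.mem_A j u (hj.trans hi.symm)) hu
  · exact absurd (hs.mem_A i u (hi.trans hj.symm)) hu
  · exact hs.slotsInj i j v hi hj

lemma threshold_accept (hs : s.Invariant f q l) (rule : SlotRule Ω k) (hu : u ∉ s.A) (x : ℝ) :
    (s.accept rule u x).threshold
      = s.threshold + (alpha k - 3) * x - alpha k * s.slotWeight (rule.slot s) := by
  have h1 : ∑ v ∈ s.A, Function.update s.w u x v = ∑ v ∈ s.A, s.w v :=
    sum_congr rfl fun v hv => Function.update_of_ne (ne_of_mem_of_not_mem hv hu) _ _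
  have h2 : ∑ v ∈ (s.accept rule u x).A, (s.accept rule u x).w v = x + ∑ v ∈ s.A, s.w v := by
    simp only [State.accept]
    rw [sum_insert hu, h1, Function.update_self]
  have h3 : ∑ j, s.slotWeight j
      = s.slotWeight (rule.slot s) + ∑ j ∈ univ \ {rule.slot s}, s.slotWeight j := by
    rw [← sum_sdiff (subset_univ {rule.slot s}), sum_singleton, add_comm]
  rw [State.threshold, State.threshold, (hs.slotsInj_accept rule hu x).sum_S, hs.slotsInj.sum_S, h2,
    hs.slotWeight_accept rule hu, sum_update_of_mem (mem_univ _), h3]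
  ring

/-- Old bounds persist because enlarging A lowers the marginals of g while the threshold does not
decrease; the new weight is an exact marginal. -/
lemma accept (hs : s.Invariant f q l) (rule : SlotRule Ω k) (hk : 1 ≤ k) (hq : 1 ≤ q)
    (hα : alpha k = q ^ (3 * k + 1)) (hα' : alpha k - 3 = (3 * k : ℕ) * (q - 1) + q)
    (hf : IsSubmodular f) (hul : u ∉ l) {x : ℝ}
    (hx : x = sampled (1 / 3) f (insert u s.A) - sampled (1 / 3) f s.A)
    (hacc : s.threshold ≤ 3 * k * x) : (s.accept rule u x).Invariant f q (l ++ [u]) := by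
  have hu : u ∉ s.A := fun h => hul (List.mem_toFinset.1 (hs.A_subset h))
  have hk0 : (0 : ℝ) < 3 * k := by positivity
  have hx0 : 0 ≤ x := nonneg_of_mul_nonneg_right ((hs.threshold_nonneg hq).trans hacc) hk0
  have hanti : ∀ {A T : Finset Ω} {v : Ω}, T ⊆ A → v ∉ A →
      sampled (1 / 3) f (insert v A) - sampled (1 / 3) f A
        ≤ sampled (1 / 3) f (insert v T) - sampled (1 / 3) f T :=
    fun hTA hv => hf.sampled_marginal_anti (by norm_num) (by norm_num) hTA hv
  have hw : ∀ T ⊆ s.A, ∑ v ∈ T, Function.update s.w u x v = ∑ v ∈ T, s.w v := fun T hT =>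
    sum_congr rfl fun v hv => Function.update_of_ne (ne_of_mem_of_not_mem (hT hv) hu) _ _
  obtain ⟨L, hL, hpot⟩ := hs.potential_le
  have hm : s.slotWeight (rule.slot s) ∈ L := by
    rw [← Multiset.mem_coe, hL]
    exact Multiset.mem_map_of_mem _ (mem_univ _)
  have hmin : ∀ y ∈ L, s.slotWeight (rule.slot s) ≤ y := by
    intro y hy
    rw [← Multiset.mem_coe, hL, Multiset.mem_map] at hy
    obtain ⟨j, -, rfl⟩ := hy
    exact hs.slotWeight_slot_le rule j
  have hlen : L.length = 3 * k := by
    have := congrArg Multiset.card hL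
    simpa [mul_comm] using this
  obtain ⟨L₁, L₂, rfl⟩ := List.append_of_mem hm
  obtain ⟨hmono, hpot'⟩ := potential_replace (by omega) hq hα hα' hlen (hs.slotWeight_nonneg _)
    hmin hpot (by push_cast; exact hacc)
  rw [← hs.threshold_accept rule hu x] at hmono hpot'
  refine ⟨?_, ?_, hs.slotsInj_accept rule hu x, ?_, ?_, ?_, ?_, ?_, ?_⟩
  · exact (insert_subset_insert u hs.A_subset).trans (by intro; simp)
  · intro j v hj
    simp only [State.accept, Function.update_apply] at hj ⊢
    split_ifs at hj
    · rw [← Option.some_injective _ hj]; exact mem_insert_self _ _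
    · exact mem_insert_of_mem (hs.mem_A j v hj)
  · intro v hv
    simp only [State.accept, Function.update_apply] at hv ⊢
    split_ifs with h
    · exact hx0
    · exact hs.w_nonneg v (mem_of_mem_insert_of_ne hv h)
  · simp only [State.accept]
    rw [sum_insert hu, hw _ subset_rfl, hs.sum_w, Function.update_self, hx]
    ring
  · intro T hT
    simp only [State.accept] at hT ⊢
    by_cases huT : u ∈ T
    · obtain ⟨T, huT', rfl⟩ : ∃ T', u ∉ T' ∧ insert u T' = T :=
        ⟨T.erase u, notMem_erase u T, insert_erase huT⟩
      have hTA : T ⊆ s.A := (insert_subset_insert_iff huT').1 hT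
      rw [sum_insert huT', Function.update_self, hw _ hTA]
      -- The weight of u was measured over all of A, hence is at most its marginal over T.
      have h1 := hs.le_sampled T hTA
      have h2 := hanti hTA hu
      linarith
    · have hTA : T ⊆ s.A := (subset_insert_iff_of_notMem huT).1 hT
      rw [hw _ hTA]
      exact hs.le_sampled T hTA
  · intro v hv
    simp only [State.accept] at hv ⊢
    by_cases h : v = u
    · subst h
      rw [erase_insert hu, Function.update_self, hx]
    · have hvA := mem_of_mem_insert_of_ne hv h
      have h1 := hs.marginal_le v hvA
      have h2 := hanti (A := insert u (s.A.erase v)) (T := s.A.erase v) (v := v)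
        (subset_insert _ _) (by simp [h])
      rw [Function.update_of_ne h, erase_insert_of_ne (Ne.symm h)]
      rw [insert_comm, insert_erase hvA] at h2
      linarith
  · intro v hv hvA
    simp only [State.accept, mem_insert, not_or] at hvA
    have hvl : v ∈ l := by simpa [hvA.1] using hv
    have h1 := hs.rejected v hvl hvA.2
    have h2 := mul_le_mul_of_nonneg_left (hanti (A := insert u s.A) (T := s.A) (v := v)
      (subset_insert _ _) (by simp [hvA])) hk0.le
    exact (h2.trans h1).trans hmono
  · refine ⟨L₁ ++ L₂ ++ [x], ?_, hpot'⟩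
    rw [hs.slotWeight_accept rule hu]
    have hun : (univ : Finset (Fin k × Fin 3)).val
        = rule.slot s ::ₘ (univ.erase (rule.slot s)).val := by
      rw [← insert_val_of_notMem (notMem_erase _ _), insert_erase (mem_univ _)]
    rw [hun, Multiset.map_cons] at hL ⊢
    have hc : (univ.erase (rule.slot s)).val.map (Function.update s.slotWeight (rule.slot s) x)
        = (univ.erase (rule.slot s)).val.map s.slotWeight :=
      Multiset.map_congr rfl fun j hj => Function.update_of_ne (ne_of_mem_erase hj) _ _
    rw [hc, Function.update_self]
    -- Cancelling the replaced weight identifies `L₁ ++ L₂` with the weights of the other slots.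
    rw [Multiset.coe_eq_coe.2 List.perm_middle, ← Multiset.cons_coe] at hL
    rw [← (Multiset.cons_inj_right _).1 hL, Multiset.cons_coe, Multiset.coe_eq_coe]
    exact List.perm_append_singleton x (L₁ ++ L₂)

lemma step (hs : s.Invariant f q l) (rule : SlotRule Ω k) (hk : 1 ≤ k) (hq : 1 ≤ q)
    (hα : alpha k = q ^ (3 * k + 1)) (hα' : alpha k - 3 = (3 * k : ℕ) * (q - 1) + q)
    (hf : IsSubmodular f) (hul : u ∉ l) : (step rule f s u).Invariant f q (l ++ [u]) := by
  have hk0 : (0 : ℝ) < 3 * k := by positivity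
  rw [step_eq]
  split_ifs with h <;> rw [one_div, inv_mul_lt_iff₀ hk0] at h
  · exact hs.accept rule hk hq hα hα' hf hul rfl h.le
  · refine { hs with A_subset := hs.A_subset.trans (by simp), rejected := fun v hv hvA => ?_ }
    rcases List.mem_append.1 hv with hv | hv
    · exact hs.rejected v hv hvA
    · rw [List.mem_singleton.1 hv]; exact not_lt.1 h

lemma run (rule : SlotRule Ω k) (hk : 1 ≤ k) (hq : 1 ≤ q)
    (hα : alpha k = q ^ (3 * k + 1)) (hα' : alpha k - 3 = (3 * k : ℕ) * (q - 1) + q)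
    (hf : IsSubmodular f) (hl : l.Nodup) : (run rule f l).Invariant f q l := by
  induction l using List.reverseRecOn with
  | nil =>
    have h0 : (OnlineSubmodular.run rule f []).threshold = 0 := by
      simp [OnlineSubmodular.run, State.threshold, State.S]
    refine ⟨by simp [OnlineSubmodular.run], by simp [OnlineSubmodular.run],
      by simp [OnlineSubmodular.run, State.SlotsInj], by simp [OnlineSubmodular.run],
      by simp [OnlineSubmodular.run], fun T hT => ?_, by simp [OnlineSubmodular.run], by simp, ?_⟩
    · rw [subset_empty.1 hT]; simp
    · refine ⟨List.replicate (3 * k) 0, ?_, by rw [h0, potential_replicate_zero]⟩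
      have : (OnlineSubmodular.run rule f []).slotWeight = fun _ => 0 := rfl
      rw [this, Multiset.map_const', Multiset.coe_replicate]
      simp [mul_comm]
  | append_singleton l u ih =>
    rw [run_append]
    have h := List.nodup_append.1 hl
    exact (ih h.1).step rule hk hq hα hα' hf fun hu => h.2.2 u hu u (by simp) rfl

/-- The optimum is bounded by the value of the slots. -/
lemma le_alpha_mul (hs : s.Invariant f q l) (hk : 1 ≤ k) (hq : 1 ≤ q) (hα : 1 ≤ alpha k)
    (h0 : ∀ S, 0 ≤ f S) (hf : IsSubmodular f) {O : Finset Ω} (hOl : O ⊆ l.toFinset)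
    (hO : O.card ≤ k) : (1 - 1 / 3) * f O ≤ alpha k * sampled (1 / 3) f s.S := by
  have hk0 : (0 : ℝ) < k := by exact_mod_cast hk
  set g := sampled (1 / 3) f with hg
  have hΦ := hs.threshold_nonneg hq
  have h1 : (1 - 1 / 3) * f O ≤ sampled (1 / 3) (fun T => f (O ∪ T)) s.A := by
    have h := (hf.union_left O).le_sampled (p := 1 / 3) (by norm_num) (by norm_num) s.A
    have := h0 (O ∪ s.A)
    simp only [union_empty] at h
    linarith
  have h2 : sampled (1 / 3) (fun T => f (O ∪ T)) s.A
      ≤ g s.A + ∑ u ∈ O, (sampled (1 / 3) (fun T => f (insert u T)) s.A - g s.A) := by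
    simp only [hg, ← sampled_sub]
    rw [← sampled_sum, ← sampled_add]
    refine sampled_mono (by norm_num) (by norm_num) fun T _ => ?_
    have := hf.union_sub_le T O
    rw [union_comm O T]
    linarith
  have h3 : ∀ u ∈ O, sampled (1 / 3) (fun T => f (insert u T)) s.A - g s.A
      ≤ (if u ∈ s.A then 2 * s.w u else 0) + s.threshold / k := by
    intro u hu
    have hΦk : 0 ≤ s.threshold / k := div_nonneg hΦ hk0.le
    split_ifs with huA
    · have h := hs.marginal_le u huA
      obtain ⟨B, huB, hB⟩ : ∃ B, u ∉ B ∧ insert u B = s.A :=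
        ⟨s.A.erase u, notMem_erase u _, insert_erase huA⟩
      rw [← hB, erase_insert huB] at h
      rw [hg, ← hB, sampled_insert _ (fun T => f (insert u T)) huB]
      rw [sampled_insert _ f huB] at h ⊢
      simp only [insert_idem]
      linarith
    · have h := hs.rejected u (List.mem_toFinset.1 (hOl hu)) huA
      rw [zero_add, le_div_iff₀ hk0]
      rw [sampled_insert _ f huA] at h
      rw [hg]
      linarith
  have h4 := sum_le_sum h3
  have h5 : ∑ u ∈ O, (if u ∈ s.A then 2 * s.w u else 0) ≤ 2 * ∑ v ∈ s.A, s.w v := by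
    rw [← sum_filter, mul_sum]
    exact sum_le_sum_of_subset_of_nonneg (fun u hu => (mem_filter.1 hu).2)
      fun v hv _ => mul_nonneg zero_le_two (hs.w_nonneg v hv)
  have h6 : O.card * (s.threshold / k) ≤ s.threshold := by
    rw [← mul_div_assoc, div_le_iff₀ hk0, mul_comm]
    exact mul_le_mul_of_nonneg_left (by exact_mod_cast hO) hΦ
  rw [sum_add_distrib, sum_const, nsmul_eq_mul] at h4
  have h7 : s.S ⊆ s.A := by
    intro v hv
    simp only [State.S, mem_biUnion, mem_univ, true_and, Option.mem_toFinset, Option.mem_def] at hv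
    obtain ⟨j, hj⟩ := hv
    exact hs.mem_A j v hj
  have h8 := mul_le_mul_of_nonneg_left (hs.le_sampled s.S h7) (zero_le_one.trans hα)
  have h9 := hs.sum_w
  have h10 : s.threshold = alpha k * ∑ v ∈ s.S, s.w v - 3 * ∑ v ∈ s.A, s.w v := rfl
  have h11 := mul_le_mul_of_nonneg_right hα (h0 ∅)
  -- The 2 w(A) from the optimum's accepted elements and the w(A) in g(A) cancel the -3 w(A) in the
  -- threshold. The leftover f(∅) is at most α f(∅).
  linarith

end State.Invariant

/-! ### Competitive ratios of the modified and combined algorithms. -/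

lemma modifiedAlg_hasCompetitiveRatio (hk : 1 ≤ k) (rule : SlotRule Ω k) :
    (modifiedAlg rule).HasCompetitiveRatio k (1 / alpha k * (1 - 1 / 3)) := by
  intro f h0 hf l hl
  obtain ⟨O, hOl, hOk, hO⟩ := exists_optValue_eq k f l
  have hα := isAlpha_alpha hk
  have h4 := hα.four_le
  have hn : (0 : ℝ) < 3 * (k : ℝ) + 1 := by positivity
  -- This q is the base in the equation for α_k, so `hα.2` reads q^(3k+1) = α_k, and (3k + 1)(q - 1)
  -- = α_k - 4 gives `hα'`.
  set q : ℝ := 1 + (alpha k - 3 - 1) / (3 * (k : ℝ) + 1) with hqdef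
  have hq : 1 ≤ q := le_add_of_nonneg_right (div_nonneg (by linarith) hn.le)
  have hα' : alpha k - 3 = (3 * k : ℕ) * (q - 1) + q := by
    rw [hqdef]; push_cast; field_simp; ring
  have hs := State.Invariant.run rule hk hq hα.2.symm hα' hf hl
  have h1 := hs.le_alpha_mul hk hq (by linarith) h0 hf hOl hOk
  have h2 := hf.sampled_le_average k (run rule f l).slots hs.slotsInj
  rw [hO, modifiedAlg_expValue, one_div, mul_assoc, inv_mul_le_iff₀ (by linarith)]
  exact h1.trans (mul_le_mul_of_nonneg_left h2 (by linarith))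

lemma combinedAlg_isOnline (hk : 1 ≤ k) (rule : SlotRule Ω k) : (combinedAlg rule).IsOnline k := by
  unfold combinedAlg
  split_ifs
  exacts [singletonAlg_isOnline hk, modifiedAlg_isOnline rule]

lemma combinedAlg_hasCompetitiveRatio (hk : 1 ≤ k) (rule : SlotRule Ω k) :
    (combinedAlg rule).HasCompetitiveRatio k (max (1 / (k : ℝ)) (1 / alpha k * (1 - 1 / 3))) := by
  change (combinedAlg rule).HasCompetitiveRatio k (max (1 / (k : ℝ)) (modifiedRatio k))
  unfold combinedAlg
  split_ifs with h
  · rw [max_eq_left h]; exact singletonAlg_hasCompetitiveRatio hk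
  · rw [max_eq_right (not_le.1 h).le]; exact modifiedAlg_hasCompetitiveRatio hk rule

end Modified
end OnlineSubmodular

theorem mainTheorem9 :
    -- `α_k` is well defined
    (∀ k : ℕ, 1 ≤ k → OnlineSubmodular.IsAlpha k (OnlineSubmodular.alpha k) ∧
      ∀ a : ℝ, OnlineSubmodular.IsAlpha k a → a = OnlineSubmodular.alpha k) ∧
    -- the competitive ratios, for every slot rule (that is, for every way of breaking ties)
    (∀ (Ω : Type*) [DecidableEq Ω] (k : ℕ), 1 ≤ k →
      ((OnlineSubmodular.singletonAlg Ω).IsOnline k ∧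
        (OnlineSubmodular.singletonAlg Ω).HasCompetitiveRatio k (1 / (k : ℝ))) ∧
      Nonempty (OnlineSubmodular.SlotRule Ω k) ∧
      ∀ rule : OnlineSubmodular.SlotRule Ω k,
        ((OnlineSubmodular.modifiedAlg rule).IsOnline k ∧
          (OnlineSubmodular.modifiedAlg rule).HasCompetitiveRatio k
            (1 / OnlineSubmodular.alpha k * (1 - 1 / 3))) ∧
        ((OnlineSubmodular.combinedAlg rule).IsOnline k ∧
          (OnlineSubmodular.combinedAlg rule).HasCompetitiveRatio k
            (max (1 / (k : ℝ)) (1 / OnlineSubmodular.alpha k * (1 - 1 / 3))) ∧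
          (OnlineSubmodular.combinedAlg rule).HasCompetitiveRatio k
            (max (1 / 9) (1 / OnlineSubmodular.alpha 9 * (1 - 1 / 3))))) ∧
    -- the ratio that is guaranteed for all `k` simultaneously
    IsLeast {x : ℝ | ∃ k : ℕ, 1 ≤ k ∧
        x = max (1 / (k : ℝ)) (1 / OnlineSubmodular.alpha k * (1 - 1 / 3))}
      (max (1 / 9) (1 / OnlineSubmodular.alpha 9 * (1 - 1 / 3))) ∧
    (0.1145 : ℝ) < max (1 / 9) (1 / OnlineSubmodular.alpha 9 * (1 - 1 / 3)) := by
  refine ⟨fun k hk => ?_, fun Ω _ k hk => ?_, ?_, OnlineSubmodular.lt_max_nine⟩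
  · exact ⟨OnlineSubmodular.isAlpha_alpha hk,
      fun a ha => ha.unique (OnlineSubmodular.isAlpha_alpha hk)⟩
  · have hcomb := OnlineSubmodular.combinedAlg_hasCompetitiveRatio (Ω := Ω) hk
    exact ⟨⟨OnlineSubmodular.singletonAlg_isOnline hk,
        OnlineSubmodular.singletonAlg_hasCompetitiveRatio hk⟩,
      OnlineSubmodular.nonempty_slotRule hk, fun rule =>
        ⟨⟨OnlineSubmodular.modifiedAlg_isOnline rule,
          OnlineSubmodular.modifiedAlg_hasCompetitiveRatio hk rule⟩,
        OnlineSubmodular.combinedAlg_isOnline hk rule, hcomb rule,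
        (hcomb rule).mono (OnlineSubmodular.max_nine_le hk)⟩⟩
  · refine ⟨⟨9, by norm_num, by norm_num⟩, ?_⟩
    rintro x ⟨k, hk, rfl⟩
    exact OnlineSubmodular.max_nine_le hk
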